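/- Let $\Phi\in\mathbb R$ and let $\mathcal H=\ell^2(\mathbb Z^2)\otimes\mathbb C^2$ with orthonormal basis $|x,s\rangle$, $x\in\mathbb Z^2$, $s=\pm1$. On $\ell^2(\mathbb Z^2)$ let $T_1,T_2$ be the magnetic translations in the symmetric gauge, i.e. the unitaries $$T_1|x\rangle=e^{-ix_2\Phi/2}|x+e_1\rangle,\qquad T_2|x\rangle=e^{ix_1\Phi/2}|x+e_2\rangle ,$$ and let $W_\Phi$ be the magnetic walk, i.e. the unitary operator on $\mathcal H$ $$W_\Phi=\begin{pmatrix}T_1&0\\0&T_1^*\end{pmatrix}C_H\begin{pmatrix}T_2&0\\0&T_2^*\end{pmatrix}C_H,\qquad C_H=\frac1{\sqrt2}\begin{pmatrix}1&1\\1&-1\end{pmatrix}.$$ For a bounded operator $A$ on $\mathcal H$ put $\tau_2(A)=\frac12\sum_{s=\pm1}\langle 0,s|A|0,s\rangle$. For $\theta\in[0,2\pi)$ let $I(\theta)=\{e^{i\theta'}:0\le\theta'\le\theta\}$ and let $$N(\theta)=\tau_2\bigl(\chi_{I(\theta)}(W_\Phi)\bigr),$$ where $\chi_{I(\theta)}(W_\Phi)$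 is the spectral projection of $W_\Phi$ given by the Borel functional calculus; extend $N$ to $\mathbb R$ by $N(\theta+2\pi)=N(\theta)+1$. Then the spectral distribution function $N:\mathbb R\to\mathbb R$ is continuous, and $W_\Phi$ has no eigenvalues. -/

import Mathlib

noncomputable section

namespace MagneticWalk

/-! ### Borel functional calculus of a bounded normal operator -/

section BorelCalculus

open MeasureTheory Filter Topology
open scoped CompactlySupported ComplexOrder

/-- The positive functional `f ↦ ⟨ψ, f(a) ψ⟩` on the real continuous functions on the spectrum
of the normal operator `a`, where `f(a)` is given by the continuous functional calculus. -/
def spectralFunctional {H : Type*} [NormedAddCommGroup H] [InnerProductSpace ℂ H]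
    [CompleteSpace H] (a : H →L[ℂ] H) (ha : IsStarNormal a) (ψ : H) :
    C_c(spectrum ℂ a, ℝ) →ₚ[ℝ] ℝ :=
  PositiveLinearMap.mk₀
    { toFun := fun f =>
        (inner ℂ ψ (cfcHom ha ((⟨Complex.ofReal, Complex.continuous_ofReal⟩ : C(ℝ, ℂ)).comp
          f.toContinuousMap) ψ)).re
      map_add' := fun f g => by
        have : ((⟨Complex.ofReal, Complex.continuous_ofReal⟩ : C(ℝ, ℂ)).comp
            (f + g).toContinuousMap) =
            ((⟨Complex.ofReal, Complex.continuous_ofReal⟩ : C(ℝ, ℂ)).comp f.toContinuousMap) +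
            ((⟨Complex.ofReal, Complex.continuous_ofReal⟩ : C(ℝ, ℂ)).comp
              g.toContinuousMap) := by
          ext x; simp
        rw [this, map_add]
        simp
      map_smul' := fun c f => by
        have : ((⟨Complex.ofReal, Complex.continuous_ofReal⟩ : C(ℝ, ℂ)).comp
            (c • f).toContinuousMap) = (c : ℂ) •
            ((⟨Complex.ofReal, Complex.continuous_ofReal⟩ : C(ℝ, ℂ)).comp
              f.toContinuousMap) := by
          ext x; simp
        rw [this, map_smul]
        simp }
    (by
      intro f hf
      set s : C(spectrum ℂ a, ℂ) :=
        ⟨fun x => (Real.sqrt (f x) : ℂ), by fun_prop⟩ with hs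
      have : ((⟨Complex.ofReal, Complex.continuous_ofReal⟩ : C(ℝ, ℂ)).comp
            f.toContinuousMap) = star s * s := by
        ext x
        have hx : 0 ≤ f x := hf x
        simp [hs, ← Complex.ofReal_mul, Real.mul_self_sqrt hx]
      change 0 ≤ (inner ℂ ψ (cfcHom ha ((⟨Complex.ofReal, Complex.continuous_ofReal⟩ :
        C(ℝ, ℂ)).comp f.toContinuousMap) ψ)).re
      rw [this, map_mul, map_star, mul_apply_eq_comp,
        ContinuousLinearMap.star_eq_adjoint, ContinuousLinearMap.adjoint_inner_right]
      exact inner_self_nonneg (𝕜 := ℂ))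

/-- The spectral measure of the normal operator `a` at `ψ`, as a measure on its spectrum: the
measure with `∫ f dμ = ⟨ψ, f(a) ψ⟩` for continuous `f`. -/
def spectralMeasureAux {H : Type*} [NormedAddCommGroup H] [InnerProductSpace ℂ H]
    [CompleteSpace H] (a : H →L[ℂ] H) (ha : IsStarNormal a) (ψ : H) :
    Measure (spectrum ℂ a) :=
  RealRMK.rieszMeasure (spectralFunctional a ha ψ)

/-- The spectral measure of the normal operator `a` at `ψ`, as a measure on `ℂ`. -/
def spectralMeasure {H : Type*} [NormedAddCommGroup H] [InnerProductSpace ℂ H]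
    [CompleteSpace H] (a : H →L[ℂ] H) (ha : IsStarNormal a) (ψ : H) : Measure ℂ :=
  (spectralMeasureAux a ha ψ).map Subtype.val

instance {H : Type*} [NormedAddCommGroup H] [InnerProductSpace ℂ H]
    [CompleteSpace H] (a : H →L[ℂ] H) (ha : IsStarNormal a) (ψ : H) :
    IsFiniteMeasure (spectralMeasureAux a ha ψ) := by
  constructor
  have h := RealRMK.rieszMeasure_le_of_eq_one (spectralFunctional a ha ψ)
    (f := ⟨1, HasCompactSupport.of_compactSpace _⟩) (fun _ => zero_le_one) isCompact_univ
    (fun _ _ => rfl)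
  exact h.trans_lt ENNReal.ofReal_lt_top

instance {H : Type*} [NormedAddCommGroup H] [InnerProductSpace ℂ H]
    [CompleteSpace H] (a : H →L[ℂ] H) (ha : IsStarNormal a) (ψ : H) :
    IsFiniteMeasure (spectralMeasure a ha ψ) := by
  unfold spectralMeasure; infer_instance

theorem integral_spectralMeasureAux {H : Type*} [NormedAddCommGroup H] [InnerProductSpace ℂ H]
    [CompleteSpace H] (a : H →L[ℂ] H) (ha : IsStarNormal a) (ψ : H) (f : C(spectrum ℂ a, ℝ)) :
    ((∫ x, f x ∂(spectralMeasureAux a ha ψ) : ℝ) : ℂ) =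
      inner ℂ ψ (cfcHom ha ((⟨Complex.ofReal, Complex.continuous_ofReal⟩ : C(ℝ, ℂ)).comp f)
        ψ) := by
  have h := RealRMK.integral_rieszMeasure (spectralFunctional a ha ψ)
    ⟨f, HasCompactSupport.of_compactSpace _⟩
  have h2 : ∫ x, f x ∂(spectralMeasureAux a ha ψ) =
      (inner ℂ ψ (cfcHom ha ((⟨Complex.ofReal, Complex.continuous_ofReal⟩ : C(ℝ, ℂ)).comp f)
        ψ)).re := h
  rw [h2]
  set F := (⟨Complex.ofReal, Complex.continuous_ofReal⟩ : C(ℝ, ℂ)).comp f with hF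
  have hsa : IsSelfAdjoint (cfcHom ha F) := by
    rw [IsSelfAdjoint, ← map_star]
    congr 1
    ext x; simp [hF]
  rw [← Complex.conj_eq_iff_re, inner_conj_symm, ← ContinuousLinearMap.adjoint_inner_right,
    ← ContinuousLinearMap.star_eq_adjoint, hsa.star_eq]

theorem spectralMeasureAux_univ {H : Type*} [NormedAddCommGroup H] [InnerProductSpace ℂ H]
    [CompleteSpace H] (a : H →L[ℂ] H) (ha : IsStarNormal a) (ψ : H) :
    (spectralMeasureAux a ha ψ).real Set.univ = ‖ψ‖ ^ 2 := by
  have h := integral_spectralMeasureAux a ha ψ 1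
  have h1 : (⟨Complex.ofReal, Complex.continuous_ofReal⟩ : C(ℝ, ℂ)).comp
      (1 : C(spectrum ℂ a, ℝ)) = 1 := by ext; simp
  rw [h1, map_one] at h
  simp only [ContinuousMap.one_apply, integral_const, smul_eq_mul, mul_one,
    one_apply_eq_self, inner_self_eq_norm_sq_to_K] at h
  refine Complex.ofReal_injective (h.trans ?_)
  simp

/-- Pointwise limits of uniformly bounded quadratic forms of bounded operators are quadratic forms
of bounded operators. -/
theorem exists_operator_of_tendsto {H : Type*} [NormedAddCommGroup H] [InnerProductSpace ℂ H]
    [CompleteSpace H] (q : ℕ → H → ℂ) (q₀ : H → ℂ) (C : ℝ)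
    (hq : ∀ n, ∃ B : H →L[ℂ] H, ∀ ψ, inner ℂ ψ (B ψ) = q n ψ)
    (hlim : ∀ ψ, Tendsto (fun n => q n ψ) atTop (𝓝 (q₀ ψ)))
    (hbd : ∀ n ψ, ‖q n ψ‖ ≤ C * ‖ψ‖ ^ 2) :
    ∃ B : H →L[ℂ] H, ∀ ψ, inner ℂ ψ (B ψ) = q₀ ψ := by
  choose B hB using hq
  have hpol : ∀ n x y, inner ℂ x (B n y) =
      (q n (x + y) - q n (x - y) - Complex.I * q n (x + Complex.I • y)
        + Complex.I * q n (x - Complex.I • y)) / 4 := by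
    intro n x y
    simp only [← hB, map_add, map_sub, map_smul, inner_add_left, inner_add_right,
      inner_sub_left, inner_sub_right, inner_smul_left, inner_smul_right, Complex.conj_I]
    ring_nf
    simp only [Complex.I_sq]
    ring_nf
  have hnorm : ∀ n x y, ‖inner ℂ x (B n y)‖ ≤ C * (‖x‖ ^ 2 + ‖y‖ ^ 2) := by
    intro n x y
    have p1 := parallelogram_law_with_norm ℂ x y
    have p2 := parallelogram_law_with_norm ℂ x (Complex.I • y)
    have hI : ‖Complex.I • y‖ = ‖y‖ := by simp [norm_smul]
    rw [hI] at p2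
    rw [hpol, norm_div]
    have h4 : ‖(4 : ℂ)‖ = 4 := by simp
    rw [h4, div_le_iff₀ (by norm_num)]
    have b1 := hbd n (x + y)
    have b2 := hbd n (x - y)
    have b3 := hbd n (x + Complex.I • y)
    have b4 := hbd n (x - Complex.I • y)
    have t : ‖q n (x + y) - q n (x - y) - Complex.I * q n (x + Complex.I • y)
        + Complex.I * q n (x - Complex.I • y)‖ ≤ ‖q n (x + y)‖ + ‖q n (x - y)‖ +
          ‖q n (x + Complex.I • y)‖ + ‖q n (x - Complex.I • y)‖ := by
      refine (norm_add_le _ _).trans ?_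
      refine add_le_add ((norm_sub_le _ _).trans (add_le_add (norm_sub_le _ _) ?_)) ?_ <;> simp
    have e : C * (‖x‖ ^ 2 + ‖y‖ ^ 2) * 4 = C * ‖x + y‖ ^ 2 + C * ‖x - y‖ ^ 2
        + C * ‖x + Complex.I • y‖ ^ 2 + C * ‖x - Complex.I • y‖ ^ 2 := by
      linear_combination (-C) * p1 - C * p2
    linarith
  have hop : ∀ n y, ‖B n y‖ ≤ 2 * C * ‖y‖ := by
    intro n y
    by_cases h0 : B n y = 0
    · have : 0 ≤ C * ‖y‖ := by
        rcases eq_or_ne y 0 with rfl | hy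
        · simp
        · have := (norm_nonneg _).trans (hbd n y)
          have hy' : 0 < ‖y‖ := norm_pos_iff.mpr hy
          have hC : 0 ≤ C := nonneg_of_mul_nonneg_left this (by positivity)
          positivity
      rw [h0, norm_zero]; linarith
    · have hb : 0 < ‖B n y‖ := norm_pos_iff.mpr h0
      have hy : 0 < ‖y‖ := norm_pos_iff.mpr (fun h => h0 (by simp [h]))
      have h := hnorm n (((‖y‖ / ‖B n y‖ : ℝ) : ℂ) • B n y) y
      rw [inner_smul_left, inner_self_eq_norm_sq_to_K, norm_smul] at h
      simp only [Complex.conj_ofReal, norm_mul, Complex.norm_real, norm_div, norm_norm,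
        norm_pow, RCLike.norm_ofReal, abs_norm] at h
      have e1 : ‖y‖ / ‖B n y‖ * ‖B n y‖ ^ 2 = ‖y‖ * ‖B n y‖ := by field_simp
      have e2 : ‖y‖ / ‖B n y‖ * ‖B n y‖ = ‖y‖ := by field_simp
      rw [e1, e2] at h
      have : ‖y‖ * ‖B n y‖ ≤ ‖y‖ * (2 * C * ‖y‖) := by linarith
      exact le_of_mul_le_mul_left this hy
  set S : H → H → ℂ := fun x y => (q₀ (x + y) - q₀ (x - y) - Complex.I * q₀ (x + Complex.I • y)
        + Complex.I * q₀ (x - Complex.I • y)) / 4 with hS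
  have hSlim : ∀ x y, Tendsto (fun n => inner ℂ x (B n y)) atTop (𝓝 (S x y)) := by
    intro x y
    simp only [hpol, hS]
    exact ((((hlim _).sub (hlim _)).sub ((hlim _).const_mul _)).add
      ((hlim _).const_mul _)).div_const _
  have hSeq : ∀ x y z, Tendsto (fun n => inner ℂ x (B n y)) atTop (𝓝 z) → S x y = z :=
    fun x y z h => tendsto_nhds_unique (hSlim x y) h
  let F : H →ₗ⋆[ℂ] H →ₗ[ℂ] ℂ := LinearMap.mk₂'ₛₗ (starRingEnd ℂ) (RingHom.id ℂ) S
    (fun x x' y => hSeq _ _ _ (by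
      simp only [inner_add_left]; exact (hSlim x y).add (hSlim x' y)))
    (fun c x y => hSeq _ _ _ (by
      simp only [inner_smul_left]; exact (hSlim x y).const_mul _))
    (fun x y y' => hSeq _ _ _ (by
      simp only [map_add, inner_add_right]; exact (hSlim x y).add (hSlim x y')))
    (fun c x y => hSeq _ _ _ (by
      simp only [map_smul, inner_smul_right]; exact (hSlim x y).const_mul _))
  let G : H →L⋆[ℂ] H →L[ℂ] ℂ := F.mkContinuous₂ (2 * C) (by
    intro x y
    refine le_of_tendsto (hSlim x y).norm (Eventually.of_forall fun n => ?_)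
    calc ‖inner ℂ x (B n y)‖ ≤ ‖x‖ * ‖B n y‖ := norm_inner_le_norm _ _
      _ ≤ ‖x‖ * (2 * C * ‖y‖) := by gcongr; exact hop n y
      _ = 2 * C * ‖x‖ * ‖y‖ := by ring)
  refine ⟨ContinuousLinearMap.adjoint (InnerProductSpace.continuousLinearMapOfBilin G),
    fun ψ => ?_⟩
  rw [ContinuousLinearMap.adjoint_inner_right,
    InnerProductSpace.continuousLinearMapOfBilin_apply]
  change S ψ ψ = q₀ ψ
  exact hSeq _ _ _ (by simp only [hB]; exact hlim ψ)

theorem norm_integral_spectralMeasureAux_le {H : Type*} [NormedAddCommGroup H]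
    [InnerProductSpace ℂ H] [CompleteSpace H] (a : H →L[ℂ] H) (ha : IsStarNormal a) (ψ : H)
    (g : spectrum ℂ a → ℂ) (C : ℝ) (hg : ∀ x, ‖g x‖ ≤ C) :
    ‖∫ x, g x ∂(spectralMeasureAux a ha ψ)‖ ≤ C * ‖ψ‖ ^ 2 := by
  rw [← spectralMeasureAux_univ a ha ψ]
  exact norm_integral_le_of_norm_le_const (Eventually.of_forall hg)

theorem exists_operator_lim {H : Type*} [NormedAddCommGroup H]
    [InnerProductSpace ℂ H] [CompleteSpace H] (a : H →L[ℂ] H) (ha : IsStarNormal a)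
    (g : ℕ → spectrum ℂ a → ℂ) (g₀ : spectrum ℂ a → ℂ) (C : ℝ) (hg : ∀ n x, ‖g n x‖ ≤ C)
    (hm : ∀ n, Measurable (g n)) (hlim : ∀ x, Tendsto (fun n => g n x) atTop (𝓝 (g₀ x)))
    (hq : ∀ n, ∃ B : H →L[ℂ] H, ∀ ψ,
      inner ℂ ψ (B ψ) = ∫ x, g n x ∂(spectralMeasureAux a ha ψ)) :
    ∃ B : H →L[ℂ] H, ∀ ψ, inner ℂ ψ (B ψ) = ∫ x, g₀ x ∂(spectralMeasureAux a ha ψ) := by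
  refine exists_operator_of_tendsto _ _ C hq (fun ψ => ?_)
    (fun n ψ => norm_integral_spectralMeasureAux_le a ha ψ (g n) C (hg n))
  exact tendsto_integral_of_dominated_convergence (fun _ => C)
    (fun n => (hm n).aestronglyMeasurable) (integrable_const _)
    (fun n => Eventually.of_forall (hg n)) (Eventually.of_forall hlim)

theorem exists_operator_indicator {H : Type*} [NormedAddCommGroup H]
    [InnerProductSpace ℂ H] [CompleteSpace H] (a : H →L[ℂ] H) (ha : IsStarNormal a)
    (s : Set (spectrum ℂ a)) (hs : MeasurableSet s) :
    ∃ B : H →L[ℂ] H, ∀ ψ,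
      inner ℂ ψ (B ψ) = ∫ x, s.indicator (1 : spectrum ℂ a → ℂ) x
        ∂(spectralMeasureAux a ha ψ) := by
  have hint : ∀ (t : Set (spectrum ℂ a)) (_ : MeasurableSet t) (ψ : H),
      Integrable (t.indicator (1 : spectrum ℂ a → ℂ)) (spectralMeasureAux a ha ψ) :=
    fun t ht ψ => (integrable_const (1 : ℂ)).indicator ht
  induction s, hs using MeasurableSpace.induction_on_inter
    (borel_eq_generateFrom_isClosed (α := spectrum ℂ a) ▸ BorelSpace.measurable_eq)
    isPiSystem_isClosed with
  | empty => exact ⟨0, fun ψ => by simp⟩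
  | basic t ht =>
    have htc : IsClosed t := ht
    refine exists_operator_lim a ha (fun n x => ((htc.apprSeq n x : ℝ) : ℂ)) _ 1 ?_ ?_ ?_ ?_
    · intro n x
      simpa using HasOuterApproxClosed.apprSeq_apply_le_one htc n x
    · intro n
      exact ((Complex.continuous_ofReal.comp NNReal.continuous_coe).comp
        (htc.apprSeq n).continuous).measurable
    · intro x
      have h := (tendsto_pi_nhds.mp (HasOuterApproxClosed.tendsto_apprSeq htc)) x
      have h2 := ((Complex.continuous_ofReal.comp NNReal.continuous_coe).tendsto _).comp h
      have e : (Complex.ofReal ∘ NNReal.toReal) (t.indicator (fun _ => (1 : NNReal)) x) =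
          t.indicator (1 : spectrum ℂ a → ℂ) x := by
        by_cases hx : x ∈ t
        · rw [Set.indicator_of_mem hx, Set.indicator_of_mem hx]; simp
        · rw [Set.indicator_of_notMem hx, Set.indicator_of_notMem hx]; simp
      rw [← e]
      exact h2
    · intro n
      let f : C(spectrum ℂ a, ℝ) := ⟨fun x => (htc.apprSeq n x : ℝ), by fun_prop⟩
      refine ⟨_, fun ψ => (integral_spectralMeasureAux a ha ψ f).symm.trans ?_⟩
      exact integral_ofReal.symm
  | compl t ht ih =>
    obtain ⟨B, hB⟩ := ih
    refine ⟨1 - B, fun ψ => ?_⟩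
    have e : tᶜ.indicator (1 : spectrum ℂ a → ℂ) = fun x => 1 - t.indicator 1 x := by
      ext x; by_cases hx : x ∈ t <;> simp [hx]
    rw [e, integral_sub (integrable_const _) (hint t ht ψ), ← hB]
    simp [spectralMeasureAux_univ, inner_self_eq_norm_sq_to_K]
  | iUnion f hd hf ih =>
    choose B hB using ih
    have hsum : ∀ n x, ∑ i ∈ Finset.range n, (f i).indicator (1 : spectrum ℂ a → ℂ) x =
        (⋃ i ∈ Finset.range n, f i).indicator 1 x := by
      intro n x
      rw [Finset.indicator_biUnion_apply]
      intro i _ j _ hij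
      exact hd hij
    refine exists_operator_lim a ha
      (fun n x => ∑ i ∈ Finset.range n, (f i).indicator (1 : spectrum ℂ a → ℂ) x) _ 1
      ?_ ?_ ?_ ?_
    · intro n x
      rw [hsum]
      exact (norm_indicator_le_norm_self _ _).trans (by simp)
    · intro n
      exact Finset.measurable_fun_sum _ fun i _ => measurable_one.indicator (hf i)
    · intro x
      by_cases hx : ∃ i, x ∈ f i
      · obtain ⟨i, hi⟩ := hx
        rw [Set.indicator_of_mem (Set.mem_iUnion.mpr ⟨i, hi⟩)]
        refine tendsto_const_nhds.congr' ?_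
        filter_upwards [eventually_gt_atTop i] with n hn
        rw [hsum, Set.indicator_of_mem]
        simp only [Set.mem_iUnion]
        exact ⟨i, by simpa using hn, hi⟩
      · have hx' : ∀ i, x ∉ f i := fun i h => hx ⟨i, h⟩
        rw [Set.indicator_of_notMem (by simpa using hx')]
        simp [hx']
    · intro n
      refine ⟨∑ i ∈ Finset.range n, B i, fun ψ => ?_⟩
      rw [integral_finsetSum _ fun i _ => hint (f i) (hf i) ψ]
      simp only [← hB]
      simp

theorem exists_operator {H : Type*} [NormedAddCommGroup H]
    [InnerProductSpace ℂ H] [CompleteSpace H] (a : H →L[ℂ] H) (ha : IsStarNormal a)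
    (g : ℂ → ℂ) (hg : Measurable g) (hb : ∃ C : ℝ, ∀ z, ‖g z‖ ≤ C) :
    ∃ B : H →L[ℂ] H, ∀ ψ, inner ℂ ψ (B ψ) = ∫ z, g z ∂(spectralMeasure a ha ψ) := by
  obtain ⟨C, hC⟩ := hb
  have hgm : Measurable fun x : spectrum ℂ a => g x := hg.comp measurable_subtype_coe
  have hC0 : 0 ≤ C := (norm_nonneg _).trans (hC 0)
  have key : ∃ B : H →L[ℂ] H, ∀ ψ, inner ℂ ψ (B ψ) =
      ∫ x : spectrum ℂ a, g x ∂(spectralMeasureAux a ha ψ) := by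
    refine exists_operator_lim a ha (fun n => hgm.stronglyMeasurable.approxBounded C n) _ C
      (fun n x => hgm.stronglyMeasurable.norm_approxBounded_le hC0 n x)
      (fun n => SimpleFunc.measurable _)
      (fun x => hgm.stronglyMeasurable.tendsto_approxBounded_of_norm_le (hC x)) fun n => ?_
    generalize hgm.stronglyMeasurable.approxBounded C n = s
    induction s using SimpleFunc.induction with
    | const c hs =>
      rename_i s
      obtain ⟨B, hB⟩ := exists_operator_indicator a ha s hs
      refine ⟨c • B, fun ψ => ?_⟩
      rw [smul_apply, inner_smul_right, hB, ← integral_const_mul]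
      congr 1
      ext x
      by_cases hx : x ∈ s <;> simp [hx]
    | add hd hf hg =>
      rename_i f g
      obtain ⟨B, hB⟩ := hf
      obtain ⟨B', hB'⟩ := hg
      refine ⟨B + B', fun ψ => ?_⟩
      simp only [SimpleFunc.coe_add, Pi.add_apply, add_apply,
        inner_add_right]
      rw [integral_add (SimpleFunc.integrable_of_isFiniteMeasure f)
        (SimpleFunc.integrable_of_isFiniteMeasure g), hB, hB']
  obtain ⟨B, hB⟩ := key
  refine ⟨B, fun ψ => ?_⟩
  rw [hB, spectralMeasure, integral_map measurable_subtype_coe.aemeasurable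
    hg.aestronglyMeasurable]

/-- The Borel functional calculus: for a normal operator `a` and a bounded Borel function `g`,
the operator `g(a)` with `⟨ψ, g(a) ψ⟩ = ∫ g dμ_ψ` for all `ψ`, where `μ_ψ` is the spectral measure
of `a` at `ψ`. By polarization this determines `g(a)`. -/
def borelCalculus {H : Type*} [NormedAddCommGroup H]
    [InnerProductSpace ℂ H] [CompleteSpace H] (a : H →L[ℂ] H) (ha : IsStarNormal a)
    (g : ℂ → ℂ) (hg : Measurable g) (hb : ∃ C : ℝ, ∀ z, ‖g z‖ ≤ C) : H →L[ℂ] H :=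
  Classical.choose (exists_operator a ha g hg hb)

theorem inner_borelCalculus {H : Type*} [NormedAddCommGroup H]
    [InnerProductSpace ℂ H] [CompleteSpace H] (a : H →L[ℂ] H) (ha : IsStarNormal a)
    (g : ℂ → ℂ) (hg : Measurable g) (hb : ∃ C : ℝ, ∀ z, ‖g z‖ ≤ C) (ψ : H) :
    inner ℂ ψ (borelCalculus a ha g hg hb ψ) = ∫ z, g z ∂(spectralMeasure a ha ψ) :=
  Classical.choose_spec (exists_operator a ha g hg hb) ψ

/-- The spectral projection `χ_S(a)` of a normal operator `a` onto a Borel set `S ⊆ ℂ`. -/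
def spectralProjection {H : Type*} [NormedAddCommGroup H]
    [InnerProductSpace ℂ H] [CompleteSpace H] (a : H →L[ℂ] H) (ha : IsStarNormal a)
    (S : Set ℂ) (hS : MeasurableSet S) : H →L[ℂ] H :=
  borelCalculus a ha (S.indicator 1) (measurable_one.indicator hS)
    ⟨1, fun z => (norm_indicator_le_norm_self _ _).trans (by simp)⟩

end BorelCalculus

/-! ### The magnetic walk -/

/-- The space `ℓ²(ℤ²)`. -/
abbrev L2 : Type := lp (fun _ : ℤ × ℤ => ℂ) 2

/-- The space `ℓ²(ℤ²) ⊗ ℂ²`, as the Hilbert space direct sum of two copies of `ℓ²(ℤ²)`; the index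
`0` is the internal state `+1` and the index `1` is the internal state `-1`. -/
abbrev WalkSpace : Type := PiLp 2 (fun _ : Fin 2 => L2)

/-- The basis vector `|x⟩` of `ℓ²(ℤ²)`. -/
def siteKet (x : ℤ × ℤ) : L2 := lp.single 2 x (1 : ℂ)

/-- The basis vector `|x, s⟩` of `ℓ²(ℤ²) ⊗ ℂ²`. -/
def ket (x : ℤ × ℤ) (s : Fin 2) : WalkSpace := PiLp.single 2 s (siteKet x)

theorem memℓp_shift (e : ℤ × ℤ) (u : ℤ × ℤ → Circle) (ψ : L2) :
    Memℓp (fun x => (u x : ℂ) * ψ (x - e)) 2 := by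
  have h := lp.memℓp ψ
  rw [memℓp_gen_iff (by norm_num)] at h ⊢
  simpa [Circle.norm_coe, Function.comp_def] using (Equiv.subRight e).summable_iff.mpr h

/-- The weighted shift `ψ ↦ (x ↦ u(x) ψ(x - e))` on `ℓ²(ℤ²)`. -/
def weightedShift (e : ℤ × ℤ) (u : ℤ × ℤ → Circle) : L2 →ₗᵢ[ℂ] L2 where
  toFun ψ := ⟨fun x => (u x : ℂ) * ψ (x - e), memℓp_shift e u ψ⟩
  map_add' ψ φ := by ext x; exact mul_add _ _ _
  map_smul' c ψ := by ext x; exact mul_left_comm _ _ _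
  norm_map' ψ := by
    rw [lp.norm_eq_tsum_rpow (by norm_num), lp.norm_eq_tsum_rpow (by norm_num)]
    congr 1
    rw [← (Equiv.subRight e).tsum_eq (fun x => ‖ψ x‖ ^ (2 : ENNReal).toReal)]
    refine tsum_congr fun x => ?_
    change ‖(u x : ℂ) * ψ (x - e)‖ ^ _ = _
    simp [Circle.norm_coe]

/-- The magnetic translation `T|x⟩ = U(x)|x + e⟩`. -/
def magneticTranslation (e : ℤ × ℤ) (U : ℤ × ℤ → Circle) : L2 →L[ℂ] L2 :=
  (weightedShift e (fun x => U (x - e))).toContinuousLinearMap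

theorem magneticTranslation_apply (e : ℤ × ℤ) (U : ℤ × ℤ → Circle) (ψ : L2) (x : ℤ × ℤ) :
    magneticTranslation e U ψ x = (U (x - e) : ℂ) * ψ (x - e) := rfl

theorem magneticTranslation_ket (e : ℤ × ℤ) (U : ℤ × ℤ → Circle) (x : ℤ × ℤ) :
    magneticTranslation e U (siteKet x) = (U x : ℂ) • siteKet (x + e) := by
  ext y
  rw [magneticTranslation_apply]
  simp only [siteKet, lp.coeFn_smul, Pi.smul_apply, lp.single_apply, Pi.single_apply,
    smul_eq_mul, sub_eq_iff_eq_add]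
  split_ifs with h
  · subst h; simp
  · simp

theorem magneticTranslation_mem_unitary (e : ℤ × ℤ) (U : ℤ × ℤ → Circle) :
    magneticTranslation e U ∈ unitary (L2 →L[ℂ] L2) := by
  have h1 : star (magneticTranslation e U) * magneticTranslation e U = 1 := by
    ext1 ψ
    refine ext_inner_right ℂ fun φ => ?_
    rw [mul_apply_eq_comp, ContinuousLinearMap.star_eq_adjoint,
      ContinuousLinearMap.adjoint_inner_left]
    exact (weightedShift e _).inner_map_map ψ φ
  let R : L2 →L[ℂ] L2 := (weightedShift (-e) (fun x => (U x)⁻¹)).toContinuousLinearMap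
  have hR : magneticTranslation e U * R = 1 := by
    ext ψ x
    change (U (x - e) : ℂ) * (((U (x - e))⁻¹ : Circle) * ψ (x - e - -e)) = ψ x
    simp
  refine Unitary.mem_iff.mpr ⟨h1, ?_⟩
  rwa [left_inv_eq_right_inv h1 hR]

/-- The magnetic translation `T₁` in the symmetric gauge, `U₁(x) = exp(-i x₂ Φ/2)`. -/
def T₁ (Φ : ℝ) : L2 →L[ℂ] L2 :=
  magneticTranslation (1, 0) (fun x => Circle.exp (-(x.2 * Φ / 2)))

/-- The magnetic translation `T₂` in the symmetric gauge, `U₂(x) = exp(i x₁ Φ/2)`. -/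
def T₂ (Φ : ℝ) : L2 →L[ℂ] L2 :=
  magneticTranslation (0, 1) (fun x => Circle.exp (x.1 * Φ / 2))

/-- The operator on `ℓ²(ℤ²) ⊗ ℂ²` of a `2 × 2` matrix of operators on `ℓ²(ℤ²)`. -/
def blockOperator (A : Matrix (Fin 2) (Fin 2) (L2 →L[ℂ] L2)) : WalkSpace →L[ℂ] WalkSpace :=
  (PiLp.continuousLinearEquiv 2 ℂ (fun _ : Fin 2 => L2)).symm.toContinuousLinearMap ∘L
    ContinuousLinearMap.pi (fun i => ∑ j, A i j ∘L PiLp.proj 2 (fun _ : Fin 2 => L2) j)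

theorem blockOperator_apply (A : Matrix (Fin 2) (Fin 2) (L2 →L[ℂ] L2)) (ψ : WalkSpace)
    (i : Fin 2) : blockOperator A ψ i = ∑ j, A i j (ψ j) := by
  simp [blockOperator]

theorem blockOperator_mul (A B : Matrix (Fin 2) (Fin 2) (L2 →L[ℂ] L2)) :
    blockOperator (A * B) = blockOperator A * blockOperator B := by
  ext1 ψ
  ext1 i
  simp only [blockOperator_apply, mul_apply_eq_comp, Matrix.mul_apply,
    Fin.sum_univ_two, add_apply, map_add]
  abel

theorem blockOperator_one : blockOperator 1 = 1 := by
  ext1 ψ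
  ext1 i
  fin_cases i <;> simp [blockOperator_apply]

theorem blockOperator_star (A : Matrix (Fin 2) (Fin 2) (L2 →L[ℂ] L2)) :
    blockOperator (star A) = star (blockOperator A) := by
  rw [ContinuousLinearMap.star_eq_adjoint, ContinuousLinearMap.eq_adjoint_iff]
  intro ψ φ
  simp only [PiLp.inner_apply, blockOperator_apply, Fin.sum_univ_two, Matrix.star_apply,
    ContinuousLinearMap.star_eq_adjoint, inner_add_left, inner_add_right,
    ContinuousLinearMap.adjoint_inner_left]
  ring

/-- The block diagonal shift with entries `T` and `T*`. -/
def shiftMatrix (T : L2 →L[ℂ] L2) : Matrix (Fin 2) (Fin 2) (L2 →L[ℂ] L2) :=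
  !![T, 0; 0, star T]

/-- The Hadamard matrix. -/
def hadamard : Matrix (Fin 2) (Fin 2) ℂ :=
  ((1 / Real.sqrt 2 : ℝ) : ℂ) • !![1, 1; 1, -1]

/-- The coin `𝟙 ⊗ C_H`, as a matrix of operators. -/
def coinMatrix : Matrix (Fin 2) (Fin 2) (L2 →L[ℂ] L2) :=
  hadamard.map (algebraMap ℂ (L2 →L[ℂ] L2))

/-- The magnetic walk `W_Φ = diag(T₁, T₁*) C_H diag(T₂, T₂*) C_H`. -/
def walk (Φ : ℝ) : WalkSpace →L[ℂ] WalkSpace :=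
  blockOperator (shiftMatrix (T₁ Φ) * coinMatrix * shiftMatrix (T₂ Φ) * coinMatrix)

theorem shiftMatrix_mem_unitary (T : L2 →L[ℂ] L2) (hT : T ∈ unitary (L2 →L[ℂ] L2)) :
    shiftMatrix T ∈ unitary (Matrix (Fin 2) (Fin 2) (L2 →L[ℂ] L2)) := by
  obtain ⟨h1, h2⟩ := Unitary.mem_iff.mp hT
  refine Unitary.mem_iff.mpr ⟨?_, ?_⟩ <;> ext1 i j <;> fin_cases i <;> fin_cases j <;>
    simp [shiftMatrix, Matrix.mul_apply, h1, h2]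

theorem coinMatrix_mem_unitary :
    coinMatrix ∈ unitary (Matrix (Fin 2) (Fin 2) (L2 →L[ℂ] L2)) := by
  have hstar : star coinMatrix = coinMatrix := by
    have : star hadamard = hadamard := by
      ext i j; fin_cases i <;> fin_cases j <;> simp [hadamard]
    conv_rhs => rw [coinMatrix, ← this]
    ext1 i j
    simp only [coinMatrix, Matrix.star_apply, Matrix.map_apply]
    exact (algebraMap_star_comm (A := L2 →L[ℂ] L2) _).symm
  have hsq : coinMatrix * coinMatrix = 1 := by
    have h2 : ((Real.sqrt 2 : ℝ) : ℂ) * (Real.sqrt 2 : ℝ) = 2 := by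
      rw [← Complex.ofReal_mul, Real.mul_self_sqrt (by norm_num)]; norm_num
    have : hadamard * hadamard = 1 := by
      have h3 : ((Real.sqrt 2 : ℝ) : ℂ)⁻¹ * ((Real.sqrt 2 : ℝ) : ℂ)⁻¹ = 1 / 2 := by
        rw [← mul_inv, h2]; norm_num
      ext i j; fin_cases i <;> fin_cases j <;>
        simp [hadamard, Matrix.mul_apply, h3] <;> norm_num
    rw [coinMatrix, ← Matrix.map_mul, this, Matrix.map_one _ (map_zero _) (map_one _)]
  exact Unitary.mem_iff.mpr ⟨by rw [hstar, hsq], by rw [hstar, hsq]⟩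

theorem walk_mem_unitary (Φ : ℝ) : walk Φ ∈ unitary (WalkSpace →L[ℂ] WalkSpace) := by
  have h := mul_mem (mul_mem (mul_mem
    (shiftMatrix_mem_unitary _ (magneticTranslation_mem_unitary (1, 0)
      (fun x => Circle.exp (-(x.2 * Φ / 2))))) coinMatrix_mem_unitary)
    (shiftMatrix_mem_unitary _ (magneticTranslation_mem_unitary (0, 1)
      (fun x => Circle.exp (x.1 * Φ / 2))))) coinMatrix_mem_unitary
  obtain ⟨h1, h2⟩ := Unitary.mem_iff.mp h
  refine Unitary.mem_iff.mpr ⟨?_, ?_⟩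
  · rw [walk, ← blockOperator_star, ← blockOperator_mul, ← blockOperator_one]
    exact congrArg _ h1
  · rw [walk, ← blockOperator_star, ← blockOperator_mul, ← blockOperator_one]
    exact congrArg _ h2

theorem walk_isStarNormal (Φ : ℝ) : IsStarNormal (walk Φ) := by
  obtain ⟨h1, h2⟩ := Unitary.mem_iff.mp (walk_mem_unitary Φ)
  exact ⟨h1.trans h2.symm⟩

/-! ### The spectral distribution function -/

/-- The functional `τ(a) = ⟨0|a|0⟩` on operators on `ℓ²(ℤ²)`. -/
def tau (a : L2 →L[ℂ] L2) : ℂ := inner ℂ (siteKet 0) (a (siteKet 0))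

/-- The `(i, j)` entry of an operator on `ℓ²(ℤ²) ⊗ ℂ²`. -/
def entry (A : WalkSpace →L[ℂ] WalkSpace) (i j : Fin 2) : L2 →L[ℂ] L2 :=
  PiLp.proj 2 (fun _ : Fin 2 => L2) i ∘L A ∘L
    ((PiLp.continuousLinearEquiv 2 ℂ (fun _ : Fin 2 => L2)).symm.toContinuousLinearMap ∘L
      ContinuousLinearMap.single ℂ (fun _ : Fin 2 => L2) j)

theorem entry_blockOperator (A : Matrix (Fin 2) (Fin 2) (L2 →L[ℂ] L2)) (i j : Fin 2) :
    entry (blockOperator A) i j = A i j := by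
  ext1 ψ
  fin_cases j <;> simp [entry, blockOperator_apply]

/-- The normalized trace `τ₂ = ½ tr ⊗ τ`. -/
def tau₂ (A : WalkSpace →L[ℂ] WalkSpace) : ℂ := (1 / 2) * ∑ j, tau (entry A j j)

theorem tau₂_eq (A : WalkSpace →L[ℂ] WalkSpace) :
    tau₂ A = (1 / 2) * ∑ s, inner ℂ (ket 0 s) (A (ket 0 s)) := by
  have h : ∀ s, tau (entry A s s) = inner ℂ (ket 0 s) (A (ket 0 s)) := by
    intro s
    have e : entry A s s (siteKet 0) = A (ket 0 s) s := rfl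
    rw [tau, e]
    fin_cases s <;> simp [ket, PiLp.inner_apply, Fin.sum_univ_two]
  simp only [tau₂, h]

/-- The arc `I(θ) = {exp(iθ') : 0 ≤ θ' ≤ θ}`. -/
def arc (θ : ℝ) : Set ℂ := (fun t : ℝ => Complex.exp (Complex.I * t)) '' Set.Icc 0 θ

theorem measurableSet_arc (θ : ℝ) : MeasurableSet (arc θ) :=
  (isCompact_Icc.image (by fun_prop)).measurableSet

/-- The spectral projection `E_θ = χ_{I(θ)}(W_Φ)`. -/
def arcProjection (Φ θ : ℝ) : WalkSpace →L[ℂ] WalkSpace :=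
  spectralProjection (walk Φ) (walk_isStarNormal Φ) (arc θ) (measurableSet_arc θ)

/-- The spectral distribution function of `W_Φ`: it is `τ₂(E_θ)` (a real number) for
`θ ∈ [0, 2π)`, extended to all real `θ` by `N(θ + 2π) = N(θ) + 1`. -/
def spectralDistribution (Φ θ : ℝ) : ℝ :=
  toIcoDiv Real.two_pi_pos 0 θ + (tau₂ (arcProjection Φ (toIcoMod Real.two_pi_pos 0 θ))).re

theorem spectralDistribution_of_mem (Φ θ : ℝ) (hθ : θ ∈ Set.Ico 0 (2 * Real.pi)) :
    (spectralDistribution Φ θ : ℂ) = tau₂ (arcProjection Φ θ) := by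
  have h1 : toIcoMod Real.two_pi_pos 0 θ = θ :=
    (toIcoMod_eq_self Real.two_pi_pos).mpr (by simpa using hθ)
  have h2 : toIcoDiv Real.two_pi_pos 0 θ = 0 :=
    toIcoDiv_eq_of_sub_zsmul_mem_Ico Real.two_pi_pos (by simpa using hθ)
  have h3 : ∀ ψ, ∃ r : ℝ, inner ℂ ψ (arcProjection Φ θ ψ) = (r : ℂ) := by
    intro ψ
    rw [arcProjection, spectralProjection, inner_borelCalculus]
    rw [MeasureTheory.integral_indicator (measurableSet_arc θ)]
    exact ⟨MeasureTheory.Measure.real _ _, by simp; rfl⟩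
  obtain ⟨r, hr⟩ := h3 (ket 0 0)
  obtain ⟨r', hr'⟩ := h3 (ket 0 1)
  rw [spectralDistribution, h1, h2, tau₂_eq, Fin.sum_univ_two, hr, hr']
  have : (1 / 2 : ℂ) * (r + r') = ((1 / 2 * (r + r') : ℝ) : ℂ) := by push_cast; ring
  rw [this, Complex.ofReal_re]
  simp

theorem spectralDistribution_add_two_pi (Φ θ : ℝ) :
    spectralDistribution Φ (θ + 2 * Real.pi) = spectralDistribution Φ θ + 1 := by
  rw [spectralDistribution, toIcoDiv_add_right, toIcoMod_add_right, spectralDistribution]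
  push_cast
  ring

/-- The point spectrum, i.e. the set of eigenvalues. -/
def pointSpectrum {H : Type*} [NormedAddCommGroup H] [InnerProductSpace ℂ H]
    (a : H →L[ℂ] H) : Set ℂ :=
  {z | Module.End.HasEigenvalue (a : H →ₗ[ℂ] H) z}

end MagneticWalk

end

namespace MagneticWalk

/-! ### Traces of projections, and atoms of spectral measures of contractions. -/

section General

open MeasureTheory Filter Topology

/-! The argument plays volume against surface. Let `E` be the eigenspace of the walk at `z ≠ 0`. The
eigenvalue equation is a recursion on the lattice, so an element of `E` is determined on the square
`[0, L]²` by its values on four lines (`eigenvector_eq_zero_on_square`). Hence the projection onto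
`E`, traced over the square, is at most the number of coordinates on these lines, which is of order
`L` (`sum_norm_starProjection_sq_le_card`). The magnetic translations of the dual gauge commute with
the walk (`walk_walkTranslation`). They move an eigenvector to any site, so a nonzero one would
force every diagonal entry of the projection, in some fixed internal state, above a constant `δ >
0`, and the trace would grow like `L²`. Thus `E = 0`.

By the mean ergodic theorem a unit complex number that is not an eigenvalue carries no spectral mass
(`spectralMeasure_singleton_eq_zero`). The spectral measures therefore have no atoms on the circle,
which makes the mass of an arc continuous in its endpoint (`continuousOn_measureReal_arc`). Since
this mass runs from `0` to `1` over one turn, the extension to the real line is continuous as well.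
-/

/-- The left side is a partial trace of a projection of rank `finrank V`. Expanding it in an
orthonormal basis of `V` and exchanging the sums leaves one Bessel inequality for each basis vector.
-/
theorem sum_norm_starProjection_sq_le_finrank {H ι : Type*} [NormedAddCommGroup H]
    [InnerProductSpace ℂ H] (V : Submodule ℂ H) [FiniteDimensional ℂ V] (b : ι → H)
    (hb : Orthonormal ℂ b) (G : Finset ι) :
    ∑ i ∈ G, ‖V.starProjection (b i)‖ ^ 2 ≤ Module.finrank ℂ V := by
  let e := stdOrthonormalBasis ℂ V
  have h : ∀ x : H, ‖V.starProjection x‖ ^ 2 = ∑ j, ‖inner ℂ x (e j : H)‖ ^ 2 := by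
    intro x
    rw [Submodule.starProjection_apply, ← Submodule.coe_norm, ← e.sum_sq_norm_inner_right]
    refine Finset.sum_congr rfl fun j _ => ?_
    rw [Submodule.inner_orthogonalProjectionOnto_eq_of_mem_left, norm_inner_symm]
  simp only [h]
  rw [Finset.sum_comm]
  calc ∑ j, ∑ i ∈ G, ‖inner ℂ (b i) (e j : H)‖ ^ 2 ≤ ∑ j, (1 : ℝ) := by
        refine Finset.sum_le_sum fun j _ => (hb.sum_inner_products_le _).trans ?_
        rw [← Submodule.coe_norm, e.orthonormal.1 j, one_pow]
    _ = Module.finrank ℂ V := by simp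

/-- If the vectors of `E` are determined on the coordinates in `G` by those in `K`, then the
projection onto `E` has trace at most `#K` on the coordinates in `G`. -/
theorem sum_norm_starProjection_sq_le_card {H ι : Type*} [NormedAddCommGroup H]
    [InnerProductSpace ℂ H] (E : Submodule ℂ H) [E.HasOrthogonalProjection] (b : ι → H)
    (hb : Orthonormal ℂ b) (G K : Finset ι)
    (hdet : ∀ u ∈ E, (∀ k ∈ K, inner ℂ (b k) u = 0) → ∀ i ∈ G, inner ℂ (b i) u = 0) :
    ∑ i ∈ G, ‖E.starProjection (b i)‖ ^ 2 ≤ K.card := by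
  classical
  -- The space `V`, of dimension at most `#K`, turns out to contain the projection to `E` of every
  -- `b i` with `i ∈ G`, so on these vectors `E` may be replaced by `V`.
  set S : Finset H := K.image fun k => E.starProjection (b k) with hS
  set V : Submodule ℂ H := Submodule.span ℂ (S : Set H) with hV
  have hmem : ∀ x, E.starProjection x ∈ E := fun x => E.starProjection_apply_mem x
  have hVE : V ≤ E := by
    rw [hV, Submodule.span_le, hS]
    intro x hx
    obtain ⟨k, -, rfl⟩ := Finset.mem_image.mp (Finset.mem_coe.mp hx)
    exact hmem _
  have hinner : ∀ x, ∀ w ∈ E, inner ℂ (E.starProjection x) w = inner ℂ x w := by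
    intro x w hw
    rw [E.inner_starProjection_left_eq_right, E.starProjection_eq_self_iff.mpr hw]
  have hproj : ∀ i ∈ G, E.starProjection (b i) = V.starProjection (b i) := by
    intro i hi
    -- The part of the projected vector orthogonal to `V`. It lies in `E` and its coordinates in `K`
    -- vanish, so by `hdet` it is orthogonal to `b i`; hence it is orthogonal to itself.
    set w := E.starProjection (b i) - V.starProjection (E.starProjection (b i)) with hw
    have hwE : w ∈ E := E.sub_mem (hmem _) (hVE (V.starProjection_apply_mem _))
    have hwV : ∀ v ∈ V, inner ℂ v w = 0 := by
      intro v hv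
      rw [← inner_conj_symm, hw, V.starProjection_inner_eq_zero _ _ hv, map_zero]
    have h1 : inner ℂ (E.starProjection (b i)) w = 0 := by
      rw [hinner _ _ hwE]
      refine hdet w hwE (fun k hk => ?_) i hi
      rw [← hinner _ _ hwE]
      exact hwV _ (Submodule.subset_span (Finset.mem_coe.mpr (Finset.mem_image_of_mem _ hk)))
    have h2 : w = 0 := by
      rw [← inner_self_eq_zero (𝕜 := ℂ)]
      nth_rewrite 1 [hw]
      rw [inner_sub_left, h1, hwV _ (V.starProjection_apply_mem _), sub_zero]
    have h3 : E.starProjection (b i) ∈ V := by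
      rw [sub_eq_zero.mp (hw.symm.trans h2)]
      exact V.starProjection_apply_mem _
    exact (V.eq_starProjection_of_mem_of_inner_eq_zero h3
      fun v hv => E.starProjection_inner_eq_zero _ _ (hVE hv)).symm
  rw [Finset.sum_congr rfl fun i hi => by rw [hproj i hi]]
  refine (sum_norm_starProjection_sq_le_finrank V b hb G).trans ?_
  exact_mod_cast (finrank_span_finset_le_card S).trans Finset.card_image_le

theorem norm_inner_le_norm_starProjection_mul {H : Type*} [NormedAddCommGroup H]
    [InnerProductSpace ℂ H] (E : Submodule ℂ H) [E.HasOrthogonalProjection] (x : H) {u : H}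
    (hu : u ∈ E) : ‖inner ℂ x u‖ ≤ ‖E.starProjection x‖ * ‖u‖ := by
  have h : inner ℂ (E.starProjection x) u = inner ℂ x u := by
    rw [E.inner_starProjection_left_eq_right, E.starProjection_eq_self_iff.mpr hu]
  exact h ▸ norm_inner_le_norm _ _

/-- The spectral measures of a contraction have no atom at a point of the unit circle that is not
an eigenvalue. -/
theorem spectralMeasure_singleton_eq_zero {H : Type*} [NormedAddCommGroup H]
    [InnerProductSpace ℂ H] [CompleteSpace H] (a : H →L[ℂ] H) (ha : IsStarNormal a)
    (hnorm : ‖a‖ ≤ 1) (z : ℂ) (hz : ‖z‖ = 1) (hker : ∀ φ, a φ = z • φ → φ = 0) (ψ : H) :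
    spectralMeasure a ha ψ {z} = 0 := by
  have hzz : star z * z = 1 := by
    have := Complex.conj_mul' z
    rw [hz] at this
    simpa using this
  -- The fixed vectors of this rotated contraction are the solutions of `a φ = z • φ`, so its
  -- ergodic averages tend to `0`.
  set V : H →L[ℂ] H := star z • a with hV
  have hVn : ‖V‖ ≤ 1 := by
    rw [hV, norm_smul, norm_star, hz, one_mul]; exact hnorm
  have hlim := V.tendsto_birkhoffAverage_orthogonalProjection hVn ψ
  have hfix : ((V : H →ₗ[ℂ] H).eqLocus (1 : H →L[ℂ] H)) = ⊥ := by
    rw [eq_bot_iff]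
    intro φ hφ
    have h1 : star z • a φ = φ := hφ
    have h2 : a φ = z • φ := by
      conv_rhs => rw [← h1, smul_smul, mul_comm, hzz, one_smul]
    exact hker φ h2
  have h0 : (((V : H →ₗ[ℂ] H).eqLocus (1 : H →L[ℂ] H)).orthogonalProjectionOnto ψ : H) = 0 := by
    have := (((V : H →ₗ[ℂ] H).eqLocus (1 : H →L[ℂ] H)).orthogonalProjectionOnto ψ).2
    exact (Submodule.mem_bot ℂ).mp (hfix.le this)
  rw [h0] at hlim
  -- The ergodic average is `p(a) ψ` for a polynomial `p` with `p(z) = 1`. Thus `|p|²` dominates the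
  -- indicator of `{z}`, and its integral is the squared norm of the average.
  have hle : ∀ n : ℕ, 0 < n → (spectralMeasure a ha ψ).real {z} ≤
      ‖birkhoffAverage ℂ V id n ψ‖ ^ 2 := by
    intro n hn
    let p : C(spectrum ℂ a, ℂ) := (n : ℂ)⁻¹ • ∑ k ∈ Finset.range n,
      (star z • (ContinuousMap.id ℂ).restrict (spectrum ℂ a)) ^ k
    have hp : cfcHom ha p ψ = birkhoffAverage ℂ V id n ψ := by
      simp only [p, map_smul, map_sum, map_pow, cfcHom_id, birkhoffAverage, birkhoffSum,
        ← hV]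
      simp
    let f : C(spectrum ℂ a, ℝ) := ⟨fun x => ‖p x‖ ^ 2, by fun_prop⟩
    have hf : (⟨Complex.ofReal, Complex.continuous_ofReal⟩ : C(ℝ, ℂ)).comp f = star p * p := by
      ext x
      exact (by simp [Complex.conj_mul'] : ((‖p x‖ ^ 2 : ℝ) : ℂ) = star (p x) * p x)
    have hint : ∫ x, f x ∂(spectralMeasureAux a ha ψ) = ‖birkhoffAverage ℂ V id n ψ‖ ^ 2 := by
      have h := integral_spectralMeasureAux a ha ψ f
      rw [hf, map_mul, map_star, mul_apply_eq_comp, ContinuousLinearMap.star_eq_adjoint,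
        ContinuousLinearMap.adjoint_inner_right, hp, inner_self_eq_norm_sq_to_K] at h
      exact Complex.ofReal_injective (h.trans (by simp))
    have hms : MeasurableSet (Subtype.val ⁻¹' {z} : Set (spectrum ℂ a)) :=
      measurable_subtype_coe (measurableSet_singleton z)
    rw [← hint, spectralMeasure, map_measureReal_apply measurable_subtype_coe
      (measurableSet_singleton z), ← integral_indicator_one hms]
    refine integral_mono ((integrable_const (1 : ℝ)).indicator hms)
      (f.continuous.integrable_of_hasCompactSupport (HasCompactSupport.of_compactSpace _))
      fun x => ?_
    by_cases hx : x ∈ (Subtype.val ⁻¹' {z} : Set (spectrum ℂ a))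
    · have hx' : (x : ℂ) = z := hx
      have hpx : p x = 1 := by
        have hn' : (n : ℂ) ≠ 0 := by exact_mod_cast hn.ne'
        simp only [p, ContinuousMap.smul_apply, ContinuousMap.sum_apply, ContinuousMap.pow_apply,
          ContinuousMap.restrict_apply, ContinuousMap.id_apply, hx', smul_eq_mul, hzz]
        simp [hn']
      rw [Set.indicator_of_mem hx]
      change 1 ≤ ‖p x‖ ^ 2
      simp [hpx]
    · rw [Set.indicator_of_notMem hx]
      exact sq_nonneg ‖p x‖
  have hlim2 : Tendsto (fun n => ‖birkhoffAverage ℂ V id n ψ‖ ^ 2) atTop (𝓝 0) := by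
    simpa using hlim.norm.pow 2
  have hle0 : (spectralMeasure a ha ψ).real {z} ≤ 0 :=
    ge_of_tendsto hlim2 ((eventually_gt_atTop 0).mono hle)
  exact (measureReal_eq_zero_iff).mp (le_antisymm hle0 measureReal_nonneg)

end General

end MagneticWalk

namespace MagneticWalk

/-! ### The walk in coordinates, its commuting translations, and eigenvectors on a square. -/

section Walk

theorem star_magneticTranslation_apply (e : ℤ × ℤ) (U : ℤ × ℤ → Circle) (ψ : L2) (x : ℤ × ℤ) :
    star (magneticTranslation e U) ψ x = ((U x)⁻¹ : Circle) * ψ (x + e) := by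
  let R : L2 →L[ℂ] L2 := (weightedShift (-e) (fun x => (U x)⁻¹)).toContinuousLinearMap
  have hR : magneticTranslation e U * R = 1 := by
    ext ψ x
    change (U (x - e) : ℂ) * (((U (x - e))⁻¹ : Circle) * ψ (x - e - -e)) = ψ x
    simp
  have h := (Unitary.mem_iff.mp (magneticTranslation_mem_unitary e U)).1
  rw [left_inv_eq_right_inv h hR]
  change ((U x)⁻¹ : Circle) * ψ (x - -e) = _
  rw [sub_neg_eq_add]

/-- The phase `exp(i t / 2)`. -/
noncomputable def halfPhase (t : ℝ) : ℂ := Complex.exp (t / 2 * Complex.I)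

theorem halfPhase_ne_zero (t : ℝ) : halfPhase t ≠ 0 := Complex.exp_ne_zero _

theorem halfPhase_add (s t : ℝ) : halfPhase (s + t) = halfPhase s * halfPhase t := by
  rw [halfPhase, halfPhase, halfPhase, ← Complex.exp_add]
  push_cast
  ring_nf

theorem coe_circle_exp_eq_halfPhase (t : ℝ) : (Circle.exp (t / 2) : ℂ) = halfPhase t := by
  rw [Circle.coe_exp, halfPhase]
  push_cast
  rfl

theorem T₁_apply (Φ : ℝ) (ψ : L2) (m n : ℤ) :
    T₁ Φ ψ (m, n) = halfPhase (-(n * Φ)) * ψ (m - 1, n) := by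
  rw [T₁, magneticTranslation_apply, ← coe_circle_exp_eq_halfPhase]
  simp [neg_div]

theorem star_T₁_apply (Φ : ℝ) (ψ : L2) (m n : ℤ) :
    star (T₁ Φ) ψ (m, n) = halfPhase (n * Φ) * ψ (m + 1, n) := by
  rw [T₁, star_magneticTranslation_apply, ← coe_circle_exp_eq_halfPhase]
  simp [← Circle.exp_neg]

theorem T₂_apply (Φ : ℝ) (ψ : L2) (m n : ℤ) :
    T₂ Φ ψ (m, n) = halfPhase (m * Φ) * ψ (m, n - 1) := by
  rw [T₂, magneticTranslation_apply, ← coe_circle_exp_eq_halfPhase]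
  simp

theorem star_T₂_apply (Φ : ℝ) (ψ : L2) (m n : ℤ) :
    star (T₂ Φ) ψ (m, n) = halfPhase (-(m * Φ)) * ψ (m, n + 1) := by
  rw [T₂, star_magneticTranslation_apply, ← coe_circle_exp_eq_halfPhase]
  simp [← Circle.exp_neg, neg_div]

theorem inv_sqrt_two_mul_self :
    ((1 / Real.sqrt 2 : ℝ) : ℂ) * ((1 / Real.sqrt 2 : ℝ) : ℂ) = 1 / 2 := by
  rw [← Complex.ofReal_mul, div_mul_div_comm, Real.mul_self_sqrt (by norm_num)]
  norm_num

theorem walk_eq (Φ : ℝ) : walk Φ = blockOperator (shiftMatrix (T₁ Φ)) *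
    (blockOperator coinMatrix * (blockOperator (shiftMatrix (T₂ Φ)) *
      blockOperator coinMatrix)) := by
  rw [walk, blockOperator_mul, blockOperator_mul, blockOperator_mul, mul_assoc, mul_assoc]

theorem blockOperator_shiftMatrix_zero (T : L2 →L[ℂ] L2) (ψ : WalkSpace) :
    blockOperator (shiftMatrix T) ψ 0 = T (ψ 0) := by
  simp [blockOperator_apply, shiftMatrix]

theorem blockOperator_shiftMatrix_one (T : L2 →L[ℂ] L2) (ψ : WalkSpace) :
    blockOperator (shiftMatrix T) ψ 1 = star T (ψ 1) := by
  simp [blockOperator_apply, shiftMatrix]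

theorem blockOperator_coinMatrix_zero (ψ : WalkSpace) (x : ℤ × ℤ) :
    blockOperator coinMatrix ψ 0 x = ((1 / Real.sqrt 2 : ℝ) : ℂ) * (ψ 0 x + ψ 1 x) := by
  rw [blockOperator_apply, Fin.sum_univ_two, mul_add]
  simp [coinMatrix, hadamard, Algebra.algebraMap_eq_smul_one]
  rfl

theorem blockOperator_coinMatrix_one (ψ : WalkSpace) (x : ℤ × ℤ) :
    blockOperator coinMatrix ψ 1 x = ((1 / Real.sqrt 2 : ℝ) : ℂ) * (ψ 0 x - ψ 1 x) := by
  rw [blockOperator_apply, Fin.sum_univ_two, mul_sub]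
  simp [coinMatrix, hadamard, Algebra.algebraMap_eq_smul_one, sub_eq_add_neg]
  rfl

/-- Component `0` in column `m` depends only on column `m - 1`, whereas component `1`
(`walk_apply_one`) depends only on column `m + 1`; in both cases only rows `n ± 1` enter. The
recursion for eigenvectors rests on this. -/
theorem walk_apply_zero (Φ : ℝ) (ψ : WalkSpace) (m n : ℤ) :
    walk Φ ψ 0 (m, n) = 1 / 2 * (halfPhase (-(n * Φ)) *
      (halfPhase ((m - 1) * Φ) * (ψ 0 (m - 1, n - 1) + ψ 1 (m - 1, n - 1)) +
        halfPhase (-((m - 1) * Φ)) * (ψ 0 (m - 1, n + 1) - ψ 1 (m - 1, n + 1)))) := by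
  rw [walk_eq]
  simp only [mul_apply_eq_comp, blockOperator_shiftMatrix_zero, blockOperator_shiftMatrix_one,
    T₁_apply, T₂_apply, star_T₂_apply, blockOperator_coinMatrix_zero,
    blockOperator_coinMatrix_one]
  push_cast [← inv_sqrt_two_mul_self]
  ring

theorem walk_apply_one (Φ : ℝ) (ψ : WalkSpace) (m n : ℤ) :
    walk Φ ψ 1 (m, n) = 1 / 2 * (halfPhase (n * Φ) *
      (halfPhase ((m + 1) * Φ) * (ψ 0 (m + 1, n - 1) + ψ 1 (m + 1, n - 1)) -
        halfPhase (-((m + 1) * Φ)) * (ψ 0 (m + 1, n + 1) - ψ 1 (m + 1, n + 1)))) := by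
  rw [walk_eq]
  simp only [mul_apply_eq_comp, blockOperator_shiftMatrix_zero, blockOperator_shiftMatrix_one,
    star_T₁_apply, T₂_apply, star_T₂_apply, blockOperator_coinMatrix_zero,
    blockOperator_coinMatrix_one]
  push_cast [← inv_sqrt_two_mul_self]
  ring

/-- The magnetic translation by `y` that commutes with `T₁` and `T₂`. -/
noncomputable def dualTranslation (Φ : ℝ) (y : ℤ × ℤ) : L2 →ₗᵢ[ℂ] L2 :=
  weightedShift y fun x => Circle.exp ((y.1 * x.2 - y.2 * x.1) * Φ / 2)

theorem dualTranslation_apply (Φ : ℝ) (y : ℤ × ℤ) (ψ : L2) (m n : ℤ) :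
    dualTranslation Φ y ψ (m, n) =
      halfPhase ((y.1 * n - y.2 * m) * Φ) * ψ (m - y.1, n - y.2) := by
  rw [← coe_circle_exp_eq_halfPhase]
  rfl

/-- The magnetic translation by `y` on both components. -/
noncomputable def walkTranslation (Φ : ℝ) (y : ℤ × ℤ) : WalkSpace →ₗᵢ[ℂ] WalkSpace where
  toFun ψ := WithLp.toLp 2 fun i => dualTranslation Φ y (ψ i)
  map_add' ψ φ := by ext1 i; simp
  map_smul' c ψ := by ext1 i; simp
  norm_map' ψ := by
    change ‖WithLp.toLp 2 fun i => dualTranslation Φ y (ψ i)‖ = ‖ψ‖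
    simp [PiLp.norm_eq_of_L2]

theorem walkTranslation_apply (Φ : ℝ) (y : ℤ × ℤ) (ψ : WalkSpace) (i : Fin 2) (m n : ℤ) :
    walkTranslation Φ y ψ i (m, n) =
      halfPhase ((y.1 * n - y.2 * m) * Φ) * ψ i (m - y.1, n - y.2) :=
  dualTranslation_apply Φ y (ψ i) m n

/-- The phases of the dual translations have the sign opposite to those of `T₁` and `T₂`, which
compensates the position dependence of the latter. The two sides agree hop by hop, and `hc` reduces
each hop to an identity between sums of exponents. -/
theorem walk_walkTranslation (Φ : ℝ) (y : ℤ × ℤ) (ψ : WalkSpace) :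
    walk Φ (walkTranslation Φ y ψ) = walkTranslation Φ y (walk Φ ψ) := by
  obtain ⟨k, l⟩ := y
  have hc : ∀ (s t u s' t' u' : ℝ), s + t + u = s' + t' + u' →
    halfPhase s * halfPhase t * halfPhase u = halfPhase s' * halfPhase t' * halfPhase u' := by
    intro s t u s' t' u' h
    simp only [← halfPhase_add, h]
  ext1 i
  ext x
  obtain ⟨m, n⟩ := x
  fin_cases i
  · change walk Φ _ 0 (m, n) = walkTranslation Φ (k, l) _ 0 (m, n)
    simp only [walkTranslation_apply, walk_apply_zero]
    have h1 := hc (-(n * Φ)) ((m - 1) * Φ) ((k * (n - 1 : ℤ) - l * (m - 1 : ℤ)) * Φ)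
      ((k * n - l * m) * Φ) (-((n - l : ℤ) * Φ)) (((m - k : ℤ) - 1) * Φ) (by push_cast; ring)
    have h2 := hc (-(n * Φ)) (-((m - 1) * Φ)) ((k * (n + 1 : ℤ) - l * (m - 1 : ℤ)) * Φ)
      ((k * n - l * m) * Φ) (-((n - l : ℤ) * Φ)) (-(((m - k : ℤ) - 1) * Φ)) (by push_cast; ring)
    rw [show m - 1 - k = m - k - 1 by ring, show n - 1 - l = n - l - 1 by ring,
      show n + 1 - l = n - l + 1 by ring]
    linear_combination (1 / 2 * (ψ 0 (m - k - 1, n - l - 1) + ψ 1 (m - k - 1, n - l - 1))) * h1 +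
      (1 / 2 * (ψ 0 (m - k - 1, n - l + 1) - ψ 1 (m - k - 1, n - l + 1))) * h2
  · change walk Φ _ 1 (m, n) = walkTranslation Φ (k, l) _ 1 (m, n)
    simp only [walkTranslation_apply, walk_apply_one]
    have h1 := hc (n * Φ) ((m + 1) * Φ) ((k * (n - 1 : ℤ) - l * (m + 1 : ℤ)) * Φ)
      ((k * n - l * m) * Φ) ((n - l : ℤ) * Φ) (((m - k : ℤ) + 1) * Φ) (by push_cast; ring)
    have h2 := hc (n * Φ) (-((m + 1) * Φ)) ((k * (n + 1 : ℤ) - l * (m + 1 : ℤ)) * Φ)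
      ((k * n - l * m) * Φ) ((n - l : ℤ) * Φ) (-(((m - k : ℤ) + 1) * Φ)) (by push_cast; ring)
    rw [show m + 1 - k = m - k + 1 by ring, show n - 1 - l = n - l - 1 by ring,
      show n + 1 - l = n - l + 1 by ring]
    linear_combination (1 / 2 * (ψ 0 (m - k + 1, n - l - 1) + ψ 1 (m - k + 1, n - l - 1))) * h1 -
      (1 / 2 * (ψ 0 (m - k + 1, n - l + 1) - ψ 1 (m - k + 1, n - l + 1))) * h2

/-- An eigenvector is determined on the square `[0, L]²` by its values on the lines `m = 0`,
`n = 0`, `n = 1` and `n = L`. -/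
theorem eigenvector_eq_zero_on_square (Φ : ℝ) (z : ℂ) (hz : z ≠ 0) (ψ : WalkSpace)
    (hψ : walk Φ ψ = z • ψ) (L : ℕ)
    (hbd : ∀ (s : Fin 2) (m n : ℕ), m ≤ L → n ≤ L → m = 0 ∨ n = 0 ∨ n = 1 ∨ n = L →
      ψ s (m, n) = 0) (m : ℕ) (hm : m ≤ L) :
    ∀ (n : ℕ), n ≤ L → ψ 0 (m, n) = 0 ∧ ψ 1 (m, n) = 0 := by
  have e0 : ∀ m n : ℤ, walk Φ ψ 0 (m, n) = z * ψ 0 (m, n) := fun m n => by rw [hψ]; rfl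
  have e1 : ∀ m n : ℤ, walk Φ ψ 1 (m, n) = z * ψ 1 (m, n) := fun m n => by rw [hψ]; rfl
  induction m with
  | zero => exact fun n hn => ⟨hbd _ _ _ hm hn (Or.inl rfl), hbd _ _ _ hm hn (Or.inl rfl)⟩
  | succ m ih =>
    have ih := ih (by omega)
    -- The equation for component `0` at `(m + 1, n)` gives `z ψ₀` from column `m`, rows `n ± 1`.
    -- These rows stay in the square unless `n = 0` or `n = L`, which is where boundary data are
    -- needed.
    have hA : ∀ n ≤ L, ψ 0 ((m + 1 : ℕ), n) = 0 := by
      intro n hn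
      by_cases hb : n = 0 ∨ n = L
      · exact hbd _ _ _ hm hn (by tauto)
      · obtain ⟨j, rfl⟩ : ∃ j, n = j + 1 := ⟨n - 1, by omega⟩
        have h := e0 ((m + 1 : ℕ) : ℤ) ((j + 1 : ℕ) : ℤ)
        rw [walk_apply_zero] at h
        have i1 := ih j (by omega)
        have i2 := ih (j + 2) (by omega)
        rw [show ((m + 1 : ℕ) : ℤ) - 1 = (m : ℕ) by push_cast; ring,
          show ((j + 1 : ℕ) : ℤ) - 1 = (j : ℕ) by push_cast; ring,
          show ((j + 1 : ℕ) : ℤ) + 1 = (j + 2 : ℕ) by push_cast; ring,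
          i1.1, i1.2, i2.1, i2.2] at h
        simpa [hz] using h.symm
    -- The equation for component `1`, read in column `m` where its value is already zero, links
    -- rows `j` and `j + 2` of column `m + 1`. Given `hA` this is a two-step recursion for component
    -- `1`, started from rows `0` and `1`.
    have hB : ∀ n ≤ L, ψ 1 ((m + 1 : ℕ), n) = 0 := by
      intro n
      induction n using Nat.strong_induction_on with
      | _ n ihn =>
        intro hn
        by_cases hb : n = 0 ∨ n = 1
        · exact hbd _ _ _ hm hn (by tauto)
        · obtain ⟨j, rfl⟩ : ∃ j, n = j + 2 := ⟨n - 2, by omega⟩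
          have h := e1 (m : ℤ) ((j + 1 : ℕ) : ℤ)
          rw [walk_apply_one] at h
          rw [show (m : ℤ) + 1 = (m + 1 : ℕ) by push_cast; ring,
            show ((j + 1 : ℕ) : ℤ) - 1 = (j : ℕ) by push_cast; ring,
            show ((j + 1 : ℕ) : ℤ) + 1 = (j + 2 : ℕ) by push_cast; ring,
            (ih (j + 1) (by omega)).2, hA j (by omega), hA (j + 2) hn,
            ihn j (by omega) (by omega)] at h
          simpa [halfPhase_ne_zero] using h
    exact fun n hn => ⟨hA n hn, hB n hn⟩

theorem inner_ket (x : ℤ × ℤ) (s : Fin 2) (ψ : WalkSpace) : inner ℂ (ket x s) ψ = ψ s x := by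
  fin_cases s <;> simp [ket, siteKet, PiLp.inner_apply, Fin.sum_univ_two, lp.inner_single_left]

theorem orthonormal_ket : Orthonormal ℂ fun p : (ℤ × ℤ) × Fin 2 => ket p.1 p.2 := by
  rw [orthonormal_iff_ite]
  rintro ⟨x, s⟩ ⟨y, t⟩
  rw [inner_ket]
  fin_cases s <;> fin_cases t <;>
    simp [ket, siteKet, lp.single_apply, Pi.single_apply]

end Walk

end MagneticWalk

namespace MagneticWalk

/-! ### Absence of eigenvalues. -/

section Spectrum

open MeasureTheory Filter Topology

theorem walk_eigenvector_eq_zero (Φ : ℝ) (z : ℂ) (hz : z ≠ 0) (ψ : WalkSpace)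
    (hψ : walk Φ ψ = z • ψ) : ψ = 0 := by
  classical
  by_contra hne
  obtain ⟨s, x₀, hx₀⟩ : ∃ s x, ψ s x ≠ 0 := by
    by_contra! h
    exact hne (by ext1 s; ext x; exact h s x)
  let A : WalkSpace →L[ℂ] WalkSpace := walk Φ - z • 1
  let E : Submodule ℂ WalkSpace := LinearMap.ker (A : WalkSpace →ₗ[ℂ] WalkSpace)
  have hE : ∀ φ, φ ∈ E ↔ walk Φ φ = z • φ := by
    intro φ
    rw [← sub_eq_zero]
    exact LinearMap.mem_ker
  have hclosed : IsClosed (E : Set WalkSpace) := A.isClosed_ker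
  have : CompleteSpace E := hclosed.completeSpace_coe
  have hψn : 0 < ‖ψ‖ := norm_pos_iff.mpr hne
  set δ : ℝ := (‖ψ s x₀‖ / ‖ψ‖) ^ 2 with hδ
  have hδ0 : 0 < δ := by
    have := norm_pos_iff.mpr hx₀
    positivity
  -- Translating `ψ` by `y - x₀` keeps it in `E` with the same norm and carries the modulus of its
  -- entry at `x₀` to `y`.
  have hlow : ∀ y : ℤ × ℤ, δ ≤ ‖E.starProjection (ket y s)‖ ^ 2 := by
    intro y
    have hu : walkTranslation Φ (y - x₀) ψ ∈ E := by
      rw [hE, walk_walkTranslation, hψ, map_smul]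
    have h := norm_inner_le_norm_starProjection_mul E (ket y s) hu
    rw [inner_ket, LinearIsometry.norm_map] at h
    have hy : ‖walkTranslation Φ (y - x₀) ψ s y‖ = ‖ψ s x₀‖ := by
      obtain ⟨m, n⟩ := y
      rw [walkTranslation_apply, norm_mul, ← coe_circle_exp_eq_halfPhase, Circle.norm_coe,
        one_mul]
      simp
    rw [hy] at h
    exact pow_le_pow_left₀ (by positivity) ((div_le_iff₀ hψn).mpr h) 2
  -- The `8` counts one column and three rows in two internal states, each line with `L + 1` sites.
  -- The square contributes `(L + 1)²` sites in the single state `s`, and one factor `L + 1`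
  -- cancels.
  have hbound : ∀ L : ℕ, ((L : ℝ) + 1) * δ ≤ 8 := by
    intro L
    let R := Finset.range (L + 1)
    let emb : (ℕ × ℕ) × Fin 2 → (ℤ × ℤ) × Fin 2 := fun p => (((p.1.1 : ℤ), (p.1.2 : ℤ)), p.2)
    have hemb : Function.Injective emb := by
      rintro ⟨⟨a, b⟩, c⟩ ⟨⟨a', b'⟩, c'⟩ h
      simpa [emb] using h
    let G := ((R ×ˢ R) ×ˢ ({s} : Finset (Fin 2))).image emb
    let K := (({0} ×ˢ R ∪ R ×ˢ {0, 1, L}) ×ˢ (Finset.univ : Finset (Fin 2))).image emb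
    have hG : G.card = (L + 1) * (L + 1) := by
      simp only [G]
      rw [Finset.card_image_of_injective _ hemb]
      simp [R]
    have hK : K.card ≤ 8 * (L + 1) := by
      refine Finset.card_image_le.trans ?_
      rw [Finset.card_product, Finset.card_univ, Fintype.card_fin]
      have h1 := Finset.card_union_le (({0} : Finset ℕ) ×ˢ R) (R ×ˢ {0, 1, L})
      rw [Finset.card_product, Finset.card_product, Finset.card_singleton,
        Finset.card_range] at h1
      have h2 : ({0, 1, L} : Finset ℕ).card ≤ 3 := Finset.card_le_three
      nlinarith
    have h := sum_norm_starProjection_sq_le_card E (fun p : (ℤ × ℤ) × Fin 2 => ket p.1 p.2)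
      orthonormal_ket G K (by
        intro u hu hzero i hi
        obtain ⟨⟨⟨m, n⟩, t⟩, hp, rfl⟩ := Finset.mem_image.mp hi
        have hp : m ≤ L ∧ n ≤ L := by
          simp only [R, Finset.mem_product, Finset.mem_range] at hp
          omega
        have key := eigenvector_eq_zero_on_square Φ z hz u ((hE u).mp hu) L (by
          intro t m n hm hn hmn
          have := hzero (emb ((m, n), t)) (Finset.mem_image_of_mem _ (by
            simp only [R, Finset.mem_product, Finset.mem_union, Finset.mem_singleton,
              Finset.mem_range, Finset.mem_insert, Finset.mem_univ, and_true]
            omega))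
          rwa [inner_ket] at this) m hp.1 n hp.2
        rw [inner_ket]
        change u t ((m : ℤ), (n : ℤ)) = 0
        fin_cases t
        · exact key.1
        · exact key.2)
    have h2 : (G.card : ℝ) * δ ≤ K.card := by
      refine le_trans ?_ h
      rw [← nsmul_eq_mul]
      refine Finset.card_nsmul_le_sum _ _ _ fun i hi => ?_
      obtain ⟨⟨⟨m, n⟩, t⟩, hp, rfl⟩ := Finset.mem_image.mp hi
      have ht : t = s := by simpa using (Finset.mem_product.mp hp).2
      subst ht
      exact hlow _
    have h3 : (K.card : ℝ) ≤ 8 * (L + 1) := by exact_mod_cast hK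
    rw [hG] at h2
    push_cast at h2
    have hL : (0 : ℝ) < L + 1 := by positivity
    refine le_of_mul_le_mul_left ?_ hL
    linarith
  obtain ⟨L, hL⟩ := exists_nat_gt (8 / δ)
  have h1 := hbound L
  rw [div_lt_iff₀ hδ0] at hL
  linarith

theorem pointSpectrum_walk (Φ : ℝ) : pointSpectrum (walk Φ) = ∅ := by
  refine Set.eq_empty_of_forall_notMem fun z hz => ?_
  obtain ⟨ψ, hψ⟩ := Module.End.HasEigenvalue.exists_hasEigenvector hz
  have h : walk Φ ψ = z • ψ := hψ.apply_eq_smul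
  refine hψ.2 ?_
  rcases eq_or_ne z 0 with rfl | hz0
  · have h1 := (Unitary.mem_iff.mp (walk_mem_unitary Φ)).1
    have h2 : (star (walk Φ) * walk Φ) ψ = ψ := by rw [h1]; rfl
    rw [mul_apply_eq_comp, h, zero_smul, map_zero] at h2
    exact h2.symm
  · exact walk_eigenvector_eq_zero Φ z hz0 ψ h

theorem norm_walk_le (Φ : ℝ) : ‖walk Φ‖ ≤ 1 := by
  rw [← mul_one (walk Φ), CStarRing.norm_mem_unitary_mul _ (walk_mem_unitary Φ)]
  exact ContinuousLinearMap.norm_id_le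

theorem spectralMeasure_walk_singleton (Φ : ℝ) (ψ : WalkSpace) (z : ℂ) (hz : ‖z‖ = 1) :
    spectralMeasure (walk Φ) (walk_isStarNormal Φ) ψ {z} = 0 :=
  spectralMeasure_singleton_eq_zero _ _ (norm_walk_le Φ) z hz
    (fun φ hφ => walk_eigenvector_eq_zero Φ z (norm_ne_zero_iff.mp (by simp [hz])) φ hφ) ψ

/-! ### Spectral mass of arcs and continuity of the distribution function. -/

theorem ae_norm_eq_one_of_mem_unitary {H : Type*} [NormedAddCommGroup H] [InnerProductSpace ℂ H]
    [CompleteSpace H] (a : H →L[ℂ] H) (ha : IsStarNormal a) (hu : a ∈ unitary (H →L[ℂ] H))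
    (ψ : H) : ∀ᵐ w ∂(spectralMeasure a ha ψ), ‖w‖ = 1 := by
  rw [spectralMeasure, ae_map_iff measurable_subtype_coe.aemeasurable
    (isClosed_eq continuous_norm continuous_const).measurableSet]
  refine Eventually.of_forall fun x => ?_
  simpa using spectrum.subset_circle_of_unitary hu x.2

theorem exp_I_mul_toIcoMod_arg (w : ℂ) (hw : ‖w‖ = 1) :
    Complex.exp (Complex.I * (toIcoMod Real.two_pi_pos 0 w.arg : ℝ)) = w := by
  rw [toIcoMod, mul_comm, zsmul_eq_mul]
  push_cast
  rw [sub_mul, mul_assoc, Complex.exp_periodic.sub_int_mul_eq]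
  simpa [hw] using Complex.norm_mul_exp_arg_mul_I w

/-- The angle of `w` in `[0, 2π)` is its least nonnegative parameter. The endpoint `θ = 2π` is
included so that the full circle can be compared with `arc 0`. -/
theorem mem_arc_iff {w : ℂ} (hw : ‖w‖ = 1) {θ : ℝ} (h0 : 0 ≤ θ) (h1 : θ ≤ 2 * Real.pi) :
    w ∈ arc θ ↔ toIcoMod Real.two_pi_pos 0 w.arg ≤ θ := by
  set α := toIcoMod Real.two_pi_pos 0 w.arg with hα
  have hmem : α ∈ Set.Ico 0 (2 * Real.pi) := toIcoMod_mem_Ico' Real.two_pi_pos w.arg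
  have hexp : Complex.exp (Complex.I * α) = w := exp_I_mul_toIcoMod_arg w hw
  refine ⟨?_, fun h => ⟨α, ⟨hmem.1, h⟩, hexp⟩⟩
  rintro ⟨t, ht, htw⟩
  have htw' : Complex.exp (Complex.I * t) = w := htw
  by_contra! hlt
  rw [← hexp, Complex.exp_eq_exp_iff_exists_int] at htw'
  obtain ⟨k, hk⟩ := htw'
  have hk' : t = α + k * (2 * Real.pi) := by
    have : Complex.I * (t : ℂ) = Complex.I * ((α + k * (2 * Real.pi) : ℝ) : ℂ) := by
      rw [hk]; push_cast; ring
    exact_mod_cast mul_left_cancel₀ Complex.I_ne_zero this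
  have hlt' : t < α := ht.2.trans_lt hlt
  -- From `t < α` follows `k < 0`, while `0 ≤ t` and `α < 2π` give `k > -1`; no integer lies
  -- between.
  have hk1 : (k : ℝ) < 0 := by
    by_contra! h
    nlinarith [Real.two_pi_pos]
  have hk2 : (-1 : ℝ) < k := by
    by_contra! h
    nlinarith [Real.two_pi_pos, ht.1, hmem.2]
  have : (k : ℤ) < 0 := by exact_mod_cast hk1
  have : (-1 : ℤ) < k := by exact_mod_cast hk2
  omega

theorem continuousOn_measureReal_arc (μ : Measure ℂ) [IsFiniteMeasure μ]
    (hcirc : ∀ᵐ w ∂μ, ‖w‖ = 1) (hatom : ∀ z : ℂ, ‖z‖ = 1 → μ {z} = 0) :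
    ContinuousOn (fun θ => μ.real (arc θ)) (Set.Icc 0 (2 * Real.pi)) := by
  have hint : (fun θ => μ.real (arc θ)) =
      fun θ => ∫ w, (arc θ).indicator (1 : ℂ → ℝ) w ∂μ := by
    funext θ
    rw [integral_indicator_one (measurableSet_arc θ)]
  rw [hint]
  intro θ₀ hθ₀
  refine continuousWithinAt_of_dominated (bound := fun _ => 1)
    (Eventually.of_forall fun θ =>
      (measurable_one.indicator (measurableSet_arc θ)).aestronglyMeasurable)
    (Eventually.of_forall fun θ => Eventually.of_forall fun w =>
      (norm_indicator_le_norm_self _ _).trans (by simp)) (integrable_const _) ?_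
  -- Away from this one point, which is null, membership of `w` in `arc θ` is locally constant in
  -- `θ` near `θ₀`, so dominated convergence applies.
  have hne : ∀ᵐ w ∂μ, w ≠ Complex.exp (Complex.I * θ₀) := by
    rw [ae_iff]
    simpa using hatom (Complex.exp (Complex.I * θ₀)) (by
      rw [mul_comm]; exact Complex.norm_exp_ofReal_mul_I θ₀)
  filter_upwards [hcirc, hne] with w hw hwne
  set α := toIcoMod Real.two_pi_pos 0 w.arg with hα
  have hαne : α ≠ θ₀ := by
    intro h
    refine hwne ?_
    rw [← h, hα, exp_I_mul_toIcoMod_arg w hw]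
  refine (tendsto_const_nhds (x := (arc θ₀).indicator (1 : ℂ → ℝ) w)).congr' ?_
  have hcase : ∀ᶠ θ in 𝓝[Set.Icc 0 (2 * Real.pi)] θ₀, (α ≤ θ ↔ α ≤ θ₀) := by
    rcases lt_or_gt_of_ne hαne with h | h
    · filter_upwards [mem_nhdsWithin_of_mem_nhds (Ioi_mem_nhds h)] with θ hθ
      exact iff_of_true (le_of_lt hθ) h.le
    · filter_upwards [mem_nhdsWithin_of_mem_nhds (Iio_mem_nhds h)] with θ hθ
      exact iff_of_false (not_le.mpr hθ) (not_le.mpr h)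
  filter_upwards [hcase, self_mem_nhdsWithin] with θ hθ hmem
  have h : w ∈ arc θ ↔ w ∈ arc θ₀ := by
    rw [mem_arc_iff hw hmem.1 hmem.2, mem_arc_iff hw hθ₀.1 hθ₀.2, ← hα, hθ]
  by_cases hm : w ∈ arc θ₀
  · rw [Set.indicator_of_mem hm, Set.indicator_of_mem (h.mpr hm)]
  · rw [Set.indicator_of_notMem hm, Set.indicator_of_notMem (fun h' => hm (h.mp h'))]

theorem re_tau₂_arcProjection (Φ θ : ℝ) : (tau₂ (arcProjection Φ θ)).re = 1 / 2 *
    ∑ s, (spectralMeasure (walk Φ) (walk_isStarNormal Φ) (ket 0 s)).real (arc θ) := by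
  have h : ∀ ψ, inner ℂ ψ (arcProjection Φ θ ψ) =
      ((spectralMeasure (walk Φ) (walk_isStarNormal Φ) ψ).real (arc θ) : ℂ) := by
    intro ψ
    rw [arcProjection, spectralProjection, inner_borelCalculus,
      integral_indicator (measurableSet_arc θ)]
    simp
  rw [tau₂_eq]
  simp only [h]
  rw [← Complex.ofReal_re (1 / 2 * _)]
  push_cast
  rfl

theorem continuous_spectralDistribution (Φ : ℝ) : Continuous (spectralDistribution Φ) := by
  set μ := fun s => spectralMeasure (walk Φ) (walk_isStarNormal Φ) (ket 0 s) with hμ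
  have hcirc : ∀ s, ∀ᵐ w ∂(μ s), ‖w‖ = 1 :=
    fun s => ae_norm_eq_one_of_mem_unitary _ _ (walk_mem_unitary Φ) _
  have hatom : ∀ s (z : ℂ), ‖z‖ = 1 → μ s {z} = 0 :=
    fun s z hz => spectralMeasure_walk_singleton Φ _ z hz
  have : ∀ s, IsFiniteMeasure (μ s) := fun s => by simp only [hμ]; infer_instance
  have huniv : ∀ s, (μ s).real Set.univ = 1 := by
    intro s
    simp only [hμ]
    rw [spectralMeasure, map_measureReal_apply measurable_subtype_coe MeasurableSet.univ,
      Set.preimage_univ, spectralMeasureAux_univ, orthonormal_ket.1 (0, s), one_pow]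
  -- Subtracting the linear growth makes the endpoint values agree: at `0` because `1` is not an
  -- atom, at `2π` because the full circle has mass one. So `F` descends to a continuous function on
  -- the circle, and adding the linear term back gives `N`.
  let F : ℝ → ℝ := fun θ => 1 / 2 * ∑ s, (μ s).real (arc θ) - θ / (2 * Real.pi)
  have hF : ContinuousOn F (Set.Icc 0 (2 * Real.pi)) := by
    refine ContinuousOn.sub (continuousOn_const.mul (continuousOn_finsetSum _ fun s _ =>
      continuousOn_measureReal_arc (μ s) (hcirc s) (hatom s))) (by fun_prop)
  have hF0 : F 0 = 0 := by
    have : ∀ s, (μ s).real (arc 0) = 0 := by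
      intro s
      rw [measureReal_eq_zero_iff]
      have : arc 0 = {1} := by simp [arc]
      rw [this]
      exact hatom s 1 (by simp)
    simp [F, this]
  have hF1 : F (2 * Real.pi) = 0 := by
    have : ∀ s, (μ s).real (arc (2 * Real.pi)) = 1 := by
      intro s
      rw [← huniv s]
      refine measureReal_congr ?_
      filter_upwards [hcirc s] with w hw
      refine propext ⟨fun _ => trivial, fun _ => ?_⟩
      exact (mem_arc_iff hw Real.two_pi_pos.le le_rfl).mpr
        (toIcoMod_mem_Ico' Real.two_pi_pos w.arg).2.le
    simp [F, this]
    norm_num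
  have : Fact (0 < 2 * Real.pi) := ⟨Real.two_pi_pos⟩
  have hcont := (AddCircle.liftIco_zero_continuous (hF0.trans hF1.symm) hF).comp
    (AddCircle.continuous_mk' (2 * Real.pi))
  have heq : spectralDistribution Φ = fun θ : ℝ =>
      AddCircle.liftIco (2 * Real.pi) 0 F ((θ : ℝ) : AddCircle (2 * Real.pi)) + θ / (2 * Real.pi) := by
    funext θ
    have h1 : AddCircle.liftIco (2 * Real.pi) 0 F (θ : AddCircle (2 * Real.pi)) =
        F (toIcoMod Real.two_pi_pos 0 θ) := rfl
    have h2 := toIcoMod_add_toIcoDiv_zsmul Real.two_pi_pos 0 θ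
    rw [zsmul_eq_mul] at h2
    have h3 : θ / (2 * Real.pi) =
        toIcoMod Real.two_pi_pos 0 θ / (2 * Real.pi) + toIcoDiv Real.two_pi_pos 0 θ := by
      rw [div_add' _ _ _ Real.two_pi_pos.ne', h2]
    rw [h1, h3, spectralDistribution, re_tau₂_arcProjection]
    simp only [F, hμ]
    ring
  rw [heq]
  exact hcont.add (by fun_prop)

end Spectrum

end MagneticWalk

/-- For every magnetic flux, the spectral distribution function of the magnetic walk is
continuous, and the magnetic walk has no eigenvalues. -/
theorem mainTheorem3 (Φ : ℝ) :
    Continuous (fun θ : ℝ => MagneticWalk.spectralDistribution Φ θ) ∧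
      MagneticWalk.pointSpectrum (MagneticWalk.walk Φ) = ∅ :=
  ⟨MagneticWalk.continuous_spectralDistribution Φ, MagneticWalk.pointSpectrum_walk Φ⟩
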